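/- Let $M$ be an $n$-dimensional real normed space (a Minkowski space) with unit sphere $S=\{\mathbf{y}\in M:\|\mathbf{y}\|=1\}$. For $\mathbf{x}\in S$ let $B(-\mathbf{x},\mathbf{x})=\{\mathbf{z}\in M:\|\mathbf{z}+\mathbf{x}\|=\|\mathbf{z}-\mathbf{x}\|\}$ be the bisector of $-\mathbf{x}$ and $\mathbf{x}$. For $\mathbf{y}\in S$, the ideal point $\infty\mathbf{y}$ is said to belong to the bisector if there are real numbers $t_i\to\infty$ and vectors $\mathbf{y}_i\to\mathbf{y}$ with $t_i\mathbf{y}_i\in B(-\mathbf{x},\mathbf{x})$ for all $i$. The map $\Phi$ sends an ordinary point $\mathbf{z}\in B(-\mathbf{x},\mathbf{x})$ to $\mathbf{z}/t_{\mathbf{z}}$, where $t_{\mathbf{z}}=\|\mathbf{z}-\mathbf{x}\|=\|\mathbf{z}+\mathbf{x}\|$ is the unique $t\ge 1$ with $\mathbf{z}\in(tS+\mathbf{x})\cap(tS-\mathbf{x})$, and sends an ideal point $\infty\mathbf{y}$ of the bisector to $\mathbf{y}$. The bounded representation of the bisector is the set of the images under $\Phi$ of all ordinary and ideal points of the bisector.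 Then the following are equivalent: 1. for every $\mathbf{x}\in S$, the bounded representation of the bisector of $-\mathbf{x}$ and $\mathbf{x}$ is contained in an $(n-1)$-dimensional linear subspace of $M$ (which may depend on $\mathbf{x}$); 2. $M$ is Euclidean, i.e. linearly isometric to the Euclidean space $\mathbb{R}^n$. -/

import Mathlib

open Set Filter Topology Metric
open scoped Pointwise

namespace Minkowski

variable {E : Type*} [NormedAddCommGroup E] [NormedSpace ℝ E]

/-- `x` is isosceles orthogonal to `y`. -/
def IsoscelesOrthogonal (x y : E) : Prop := ‖x + y‖ = ‖x - y‖

/-- The (ordinary) bisector of `-x` and `x`: all vectors isosceles orthogonal to `x`. -/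
def bisector (x : E) : Set E := {y | IsoscelesOrthogonal y x}

/-- The points of the closed-ball compactification of `E`: the ordinary points of `E` together
with one ideal point `∞ y` for every unit vector `y` (so `∞ y` and `∞ (-y)` are distinct). -/
abbrev ExtendedPoint (E : Type*) [NormedAddCommGroup E] : Type _ := E ⊕ sphere (0 : E) 1

/-- The ideal point `∞ y` belongs to the bisector of `-x` and `x`: some sequence `t i • v i` of
ordinary points of the bisector tends to it, that is, `t i → ∞` and `v i → y`. -/
def IsIdealPoint (x : E) (y : sphere (0 : E) 1) : Prop :=
  ∃ (t : ℕ → ℝ) (v : ℕ → E), (∀ i, t i • v i ∈ bisector x) ∧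
    Tendsto t atTop atTop ∧ Tendsto v atTop (𝓝 (y : E))

/-- The bisector of `-x` and `x` extended by its ideal points. -/
def extendedBisector (x : E) : Set (ExtendedPoint E) :=
  Sum.inl '' bisector x ∪ Sum.inr '' {y | IsIdealPoint x y}

/-- The value `t_z` belonging to an ordinary point `z` of the bisector of `-x` and `x`. -/
def bisectorRadius (x z : E) : ℝ := ‖z - x‖

/-- For an ordinary point `z` of the bisector of `-x` and `x`, `‖x‖ = 1`, the number
`bisectorRadius x z` is the only `t ≥ 1` with `z ∈ (t S + x) ∩ (t S - x)`. -/
theorem eq_bisectorRadius_iff {x z : E} (hx : x ∈ sphere (0 : E) 1) (hz : z ∈ bisector x) (t : ℝ) :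
    t = bisectorRadius x z ↔ 1 ≤ t ∧
      z ∈ (t • sphere (0 : E) 1 + {x}) ∩ (t • sphere (0 : E) 1 - {x}) := by
  have hx1 : ‖x‖ = 1 := by simpa using hx
  have hz' : ‖z + x‖ = ‖z - x‖ := hz
  have mem : ∀ (w : E), 1 ≤ t → (w ∈ t • sphere (0 : E) 1 ↔ ‖w‖ = t) := by
    intro w ht
    have h0 : t ≠ 0 := by linarith
    rw [Set.mem_smul_set_iff_inv_smul_mem₀ h0, mem_sphere_zero_iff_norm, norm_smul, norm_inv,
      Real.norm_of_nonneg (by linarith), inv_mul_eq_one₀ h0, eq_comm]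
  have hge : 1 ≤ ‖z - x‖ := by
    have h2 : ‖(z + x) - (z - x)‖ ≤ ‖z + x‖ + ‖z - x‖ := norm_sub_le _ _
    have h3 : (z + x) - (z - x) = (2 : ℝ) • x := by rw [two_smul]; abel
    rw [h3, norm_smul, hx1, hz'] at h2
    norm_num at h2
    linarith
  have key : 1 ≤ t → ((z ∈ (t • sphere (0 : E) 1 + {x}) ∩ (t • sphere (0 : E) 1 - {x})) ↔
      ‖z - x‖ = t) := by
    intro ht
    rw [Set.add_singleton, Set.sub_singleton, Set.mem_inter_iff]
    constructor
    · rintro ⟨⟨w, hw, rfl⟩, -⟩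
      simpa using (mem w ht).1 hw
    · intro h
      exact ⟨⟨z - x, (mem _ ht).2 h, by simp⟩, ⟨z + x, (mem _ ht).2 (hz'.trans h), by simp⟩⟩
  constructor
  · rintro rfl
    exact ⟨hge, (key hge).2 rfl⟩
  · rintro ⟨ht, h⟩
    exact ((key ht).1 h).symm

/-- The map `Φ`: an ordinary point `z` goes to `z / t_z`, an ideal point `∞ y` to its radial
projection `y` on the unit sphere. -/
noncomputable def boundedMap (x : E) : ExtendedPoint E → E :=
  Sum.elim (fun z => (bisectorRadius x z)⁻¹ • z) (fun y => (y : E))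

/-- The bounded representation of the bisector of `-x` and `x`. -/
def boundedRepresentation (x : E) : Set E := boundedMap x '' extendedBisector x

/-- The normed space `E` is Euclidean: it is linearly isometric to the Euclidean space of the same
dimension. -/
def IsEuclidean (E : Type*) [NormedAddCommGroup E] [NormedSpace ℝ E] : Prop :=
  Nonempty (E ≃ₗᵢ[ℝ] EuclideanSpace ℝ (Fin (Module.finrank ℝ E)))

end Minkowski

/-! A bisector meets every line parallel to `x`. If it lies in a hyperplane, it therefore fills that
hyperplane, which misses `x`, and the linear reflection fixing it and negating `x` is an isometry
(`exists_reflection_of_bisector_subset`). Integrating `f x * f y` over the dual unit ball gives an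
inner product that these isometries preserve (`dualMomentForm_map`). Vectors of equal moment are
swapped by the reflection along their difference, so they have equal norm
(`norm_eq_of_dualMomentForm_eq`), and the squared norm is a multiple of the form. Conversely, a
Euclidean bisector lies in the hyperplane orthogonal to `x`, which is closed and so also contains
the images of ideal points. -/

namespace Minkowski

/-! ### Flat bisectors and isometric reflections -/

section Bisector

variable {E : Type*} [NormedAddCommGroup E] [NormedSpace ℝ E]

/-- The bisector of `-x` and `x` meets every line parallel to `x`. -/
theorem exists_add_smul_mem_bisector {x : E} (hx : x ≠ 0) (y : E) :
    ∃ a : ℝ, y + a • x ∈ bisector x := by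
  set N : ℝ → ℝ := fun a => ‖y + a • x‖ with hN
  have hg : Continuous fun a : ℝ => N (a + 1) - N (a - 1) := by fun_prop
  have hx0 : 0 < ‖x‖ := norm_pos_iff.2 hx
  have lower : ∀ a : ℝ, |a| * ‖x‖ - ‖y‖ ≤ N a := by
    intro a
    have := norm_sub_norm_le (a • x) (-y)
    rw [norm_neg, norm_smul, Real.norm_eq_abs, sub_neg_eq_add, add_comm (a • x)] at this
    exact this
  obtain ⟨k, hk⟩ := exists_nat_gt (‖y‖ / ‖x‖)
  have hk' : ‖y‖ < k * ‖x‖ := (div_lt_iff₀ hx0).1 hk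
  have hN0 : N 0 = ‖y‖ := by simp [hN]
  -- Otherwise `N` would never exceed `N 0` along 0, 2, 4, ..., against the growth in `lower`.
  have hpos : ∃ a, 0 ≤ N (a + 1) - N (a - 1) := by
    by_contra! h
    have step : ∀ j : ℕ, N (2 * j) ≤ N 0 := by
      intro j
      induction j with
      | zero => simp
      | succ j ih =>
        have h1 := h (2 * j + 1)
        rw [add_sub_cancel_right] at h1
        have h2 : (2 : ℝ) * (j + 1 : ℕ) = 2 * j + 1 + 1 := by push_cast; ring
        rw [h2]
        linarith
    have h1 := lower (2 * k)
    rw [abs_of_nonneg (by positivity)] at h1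
    linarith [step k]
  have hneg : ∃ a, N (a + 1) - N (a - 1) ≤ 0 := by
    by_contra! h
    have step : ∀ j : ℕ, N (-(2 * j)) ≤ N 0 := by
      intro j
      induction j with
      | zero => simp
      | succ j ih =>
        have h1 := h (-(2 * j) - 1)
        rw [sub_add_cancel] at h1
        have h2 : -((2 : ℝ) * (j + 1 : ℕ)) = -(2 * j) - 1 - 1 := by push_cast; ring
        rw [h2]
        linarith
    have h1 := lower (-(2 * k))
    rw [abs_neg, abs_of_nonneg (by positivity)] at h1
    linarith [step k]
  obtain ⟨p, hp⟩ := hpos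
  obtain ⟨q, hq⟩ := hneg
  obtain ⟨a, ha⟩ := mem_range_of_exists_le_of_exists_ge hg ⟨q, hq⟩ ⟨p, hp⟩
  refine ⟨a, ?_⟩
  have h1 : y + a • x + x = y + (a + 1) • x := by module
  have h2 : y + a • x - x = y + (a - 1) • x := by module
  change ‖y + a • x + x‖ = ‖y + a • x - x‖
  rw [h1, h2]
  exact sub_eq_zero.1 ha

/-- If the bounded representation lies in a subspace, then so does the bisector itself. -/
theorem bisector_subset_of_boundedRepresentation_subset {x : E} (hx : x ≠ 0) {H : Submodule ℝ E}
    (h : boundedRepresentation x ⊆ (H : Set E)) : bisector x ⊆ (H : Set E) := by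
  intro z hz
  have h1 : (bisectorRadius x z)⁻¹ • z ∈ H :=
    h ⟨Sum.inl z, Or.inl ⟨z, hz, rfl⟩, rfl⟩
  have h2 : (bisectorRadius x z)⁻¹ ≠ 0 := by
    refine inv_ne_zero fun h0 => hx ?_
    have h3 : z = x := sub_eq_zero.1 (norm_eq_zero.1 h0)
    have h4 : ‖z + x‖ = ‖z - x‖ := hz
    rw [h3, sub_self, norm_zero, norm_eq_zero, ← two_smul ℝ] at h4
    simpa using h4
  exact (H.smul_mem_iff h2).1 h1

/-- A bisector contained in a proper subspace is the mirror of an isometric reflection. -/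
theorem exists_reflection_of_bisector_subset {x : E} (hx : x ≠ 0) {H : Submodule ℝ E} (hH : H ≠ ⊤)
    (h : bisector x ⊆ (H : Set E)) :
    ∃ f : Module.Dual ℝ E, f x = 2 ∧ ∀ y, ‖y - f y • x‖ = ‖y‖ := by
  obtain ⟨g, hg0, hg⟩ := H.exists_le_ker_of_lt_top hH.lt_top
  have hb : ∀ z ∈ bisector x, g z = 0 := fun z hz => hg (h hz)
  -- If `g x = 0`, then `g` is constant on each line parallel to `x`; every such line meets the
  -- bisector, so `g = 0`.
  have hgx : g x ≠ 0 := by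
    intro h0
    refine hg0 (LinearMap.ext fun y => ?_)
    obtain ⟨a, ha⟩ := exists_add_smul_mem_bisector hx y
    simpa [h0] using hb _ ha
  have hker : ∀ y, g y = 0 → ‖y + x‖ = ‖y - x‖ := by
    intro y hy
    obtain ⟨a, ha⟩ := exists_add_smul_mem_bisector hx y
    have h1 := hb _ ha
    have h2 : a = 0 := by simpa [hy, hgx] using h1
    rw [h2, zero_smul, add_zero] at ha
    exact ha
  refine ⟨(2 / g x) • g, by simp [hgx], fun y => ?_⟩
  simp only [LinearMap.smul_apply, smul_eq_mul]
  set s : ℝ := g y / g x with hs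
  have hsy : 2 / g x * g y = 2 * s := by rw [hs]; ring
  rw [hsy]
  by_cases hs0 : s = 0
  · simp [hs0]
  -- `y` and its mirror image are `s • (w + x)` and `s • (w - x)` with one `w` in the kernel of `g`,
  -- so `hker` equates their norms.
  have h1 : g (s⁻¹ • (y - s • x)) = 0 := by
    simp [hs, hgx]
  have h2 : y = s • (s⁻¹ • (y - s • x) + x) := by
    rw [smul_add, smul_inv_smul₀ hs0]; abel
  have h3 : y - (2 * s) • x = s • (s⁻¹ • (y - s • x) - x) := by
    rw [smul_sub, smul_inv_smul₀ hs0]; module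
  rw [h3, norm_smul, ← hker _ h1, ← norm_smul, ← h2]

end Bisector

/-! ### An inner product invariant under isometric reflections -/

section InvariantForm

open MeasureTheory

variable {E : Type*} [NormedAddCommGroup E] [NormedSpace ℝ E] [FiniteDimensional ℝ E]

/-- The determinant of an involution is 1 or -1. -/
theorem measurePreserving_of_involutive {V : Type*} [NormedAddCommGroup V] [NormedSpace ℝ V]
    [FiniteDimensional ℝ V] [MeasurableSpace V] [BorelSpace V] (μ : Measure V)
    [μ.IsAddHaarMeasure] (T : V →ₗ[ℝ] V) (hT : Function.Involutive T) :
    MeasurePreserving T μ μ := by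
  refine ⟨T.continuous_of_finiteDimensional.measurable, ?_⟩
  have h1 : LinearMap.det T * LinearMap.det T = 1 := by
    rw [← LinearMap.det_comp, show T ∘ₗ T = LinearMap.id from LinearMap.ext hT, LinearMap.det_id]
  have h2 : |LinearMap.det T| = 1 := by
    rcases mul_self_eq_one_iff.1 h1 with h | h <;> simp [h]
  have h3 : LinearMap.det T ≠ 0 := fun h => by simp [h] at h2
  rw [Measure.map_linearMap_addHaar_eq_smul_addHaar μ h3, abs_inv, h2]
  simp

noncomputable local instance : MeasurableSpace (StrongDual ℝ E) := borel _

local instance : BorelSpace (StrongDual ℝ E) := ⟨rfl⟩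

/-- The second moment form of the unit ball of the dual space: a scalar product on `E` depending
only on the norm. -/
noncomputable def dualMomentForm (x y : E) : ℝ :=
  ∫ f in Metric.closedBall (0 : StrongDual ℝ E) 1, f x * f y ∂Measure.addHaar

theorem integrableOn_mul_apply (x y : E) :
    IntegrableOn (fun f : StrongDual ℝ E => f x * f y) (Metric.closedBall 0 1)
      Measure.addHaar :=
  ContinuousOn.integrableOn_compact (isCompact_closedBall _ _)
    (Continuous.continuousOn (by fun_prop))

theorem dualMomentForm_comm (x y : E) : dualMomentForm x y = dualMomentForm y x := by
  simp only [dualMomentForm, mul_comm]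

theorem dualMomentForm_add_left (x y z : E) :
    dualMomentForm (x + y) z = dualMomentForm x z + dualMomentForm y z := by
  simp only [dualMomentForm, map_add, add_mul]
  exact integral_add (integrableOn_mul_apply x z) (integrableOn_mul_apply y z)

theorem dualMomentForm_smul_left (a : ℝ) (x z : E) :
    dualMomentForm (a • x) z = a * dualMomentForm x z := by
  simp only [dualMomentForm, map_smul, smul_eq_mul, mul_assoc]
  exact integral_const_mul a _

theorem dualMomentForm_add_right (x y z : E) :
    dualMomentForm z (x + y) = dualMomentForm z x + dualMomentForm z y := by
  simp only [dualMomentForm_comm z, dualMomentForm_add_left]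

theorem dualMomentForm_smul_right (a : ℝ) (x z : E) :
    dualMomentForm z (a • x) = a * dualMomentForm z x := by
  simp only [dualMomentForm_comm z, dualMomentForm_smul_left]

theorem dualMomentForm_sub_left (x y z : E) :
    dualMomentForm (x - y) z = dualMomentForm x z - dualMomentForm y z := by
  rw [sub_eq_add_neg, ← neg_one_smul ℝ y, dualMomentForm_add_left, dualMomentForm_smul_left]
  ring

theorem dualMomentForm_sub_right (x y z : E) :
    dualMomentForm z (x - y) = dualMomentForm z x - dualMomentForm z y := by
  simp only [dualMomentForm_comm z, dualMomentForm_sub_left]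

theorem dualMomentForm_self_pos {x : E} (hx : x ≠ 0) : 0 < dualMomentForm x x := by
  have hint := integrableOn_mul_apply x x
  rw [dualMomentForm, setIntegral_pos_iff_support_of_nonneg_ae (f := fun f : StrongDual ℝ E => f x * f x)
    (Filter.Eventually.of_forall fun f => mul_self_nonneg (f x)) hint]
  obtain ⟨g, hg1, hgx⟩ := exists_dual_vector ℝ x (norm_ne_zero_iff.2 hx)
  have hopen : IsOpen ({f : StrongDual ℝ E | f x * f x ≠ 0} ∩ Metric.ball 0 1) := by
    refine IsOpen.inter ?_ Metric.isOpen_ball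
    exact isOpen_ne_fun (by fun_prop) continuous_const
  -- Half of a norming functional of `x` lies in the open ball and does not vanish at `x`.
  refine (hopen.measure_pos Measure.addHaar ⟨(2⁻¹ : ℝ) • g, ?_, ?_⟩).trans_le
    (measure_mono (Set.inter_subset_inter_right _ Metric.ball_subset_closedBall))
  · simp [hgx, hx]
  · rw [mem_ball_zero_iff, norm_smul, hg1]
    norm_num

/-- Precomposition with `R` is a norm-preserving involution of the dual, so it preserves both the
unit ball and Haar measure. -/
theorem dualMomentForm_map {R : E →ₗ[ℝ] E} (hR : Function.Involutive R)
    (hnorm : ∀ y, ‖R y‖ = ‖y‖) (x y : E) :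
    dualMomentForm (R x) (R y) = dualMomentForm x y := by
  let L : E →L[ℝ] E := LinearMap.toContinuousLinearMap R
  let T : StrongDual ℝ E →ₗ[ℝ] StrongDual ℝ E :=
    { toFun := fun f => f.comp L
      map_add' := fun f g => rfl
      map_smul' := fun a f => rfl }
  have hTapp : ∀ f z, T f z = f (R z) := fun f z => rfl
  have hT : Function.Involutive T := fun f => by
    ext z
    rw [hTapp, hTapp, hR z]
  have hle : ∀ f, ‖T f‖ ≤ ‖f‖ := fun f =>
    (T f).opNorm_le_bound (norm_nonneg f) fun z => by
      rw [hTapp, ← hnorm z]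
      exact f.le_opNorm _
  have hTnorm : ∀ f, ‖T f‖ = ‖f‖ := fun f =>
    le_antisymm (hle f) (by simpa [hT f] using hle (T f))
  have hpre : T ⁻¹' Metric.closedBall 0 1 = Metric.closedBall 0 1 := by
    ext f
    simp [hTnorm]
  have hmp := measurePreserving_of_involutive (Measure.addHaar (G := StrongDual ℝ E)) T hT
  have hemb : MeasurableEmbedding T :=
    (Homeomorph.mk hT.toPerm T.continuous_of_finiteDimensional
      T.continuous_of_finiteDimensional).measurableEmbedding
  have h := hmp.setIntegral_preimage_emb hemb (fun f => f x * f y) (Metric.closedBall 0 1)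
  rw [hpre] at h
  exact h

/-- The isometric reflection in the direction `x` is orthogonal for the moment form. -/
theorem apply_mul_dualMomentForm_self {x : E} {f : Module.Dual ℝ E} (hf : f x = 2)
    (hnorm : ∀ y, ‖y - f y • x‖ = ‖y‖) (y : E) :
    f y * dualMomentForm x x = 2 * dualMomentForm x y := by
  -- The reflection sends `x` to `-x`, so invariance is a linear equation for `f y`.
  have h := dualMomentForm_map (R := (Module.reflection hf).toLinearMap)
    (Module.involutive_reflection hf)
    (fun y => by simpa [Module.reflection_apply] using hnorm y) x y
  simp only [LinearEquiv.coe_coe, Module.reflection_apply, hf, dualMomentForm_sub_left,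
    dualMomentForm_sub_right, dualMomentForm_smul_left, dualMomentForm_smul_right] at h
  linarith

/-- Equal moments force `f u = 1` for the reflection along `u - v`, which therefore takes `u` to
`v`. -/
theorem norm_eq_of_dualMomentForm_eq
    (h : ∀ x : E, x ≠ 0 → ∃ f : Module.Dual ℝ E, f x = 2 ∧ ∀ y, ‖y - f y • x‖ = ‖y‖)
    {u v : E} (huv : dualMomentForm u u = dualMomentForm v v) : ‖u‖ = ‖v‖ := by
  rcases eq_or_ne u v with rfl | hne
  · rfl
  obtain ⟨f, hf, hnorm⟩ := h (u - v) (sub_ne_zero.2 hne)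
  have h1 := apply_mul_dualMomentForm_self hf hnorm u
  have h2 : 2 * dualMomentForm (u - v) u = dualMomentForm (u - v) (u - v) := by
    simp only [dualMomentForm_sub_left, dualMomentForm_sub_right, dualMomentForm_comm v u]
    linarith
  have h3 : f u = 1 := by
    rw [h2] at h1
    exact mul_right_cancel₀ (dualMomentForm_self_pos (sub_ne_zero.2 hne)).ne'
      (h1.trans (one_mul _).symm)
  have h4 := hnorm u
  rw [h3, one_smul, sub_sub_cancel] at h4
  exact h4.symm

theorem exists_norm_sq_eq_mul_dualMomentForm
    (h : ∀ x : E, x ≠ 0 → ∃ f : Module.Dual ℝ E, f x = 2 ∧ ∀ y, ‖y - f y • x‖ = ‖y‖) :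
    ∃ c : ℝ, ∀ x : E, ‖x‖ ^ 2 = c * dualMomentForm x x := by
  rcases subsingleton_or_nontrivial E with hE | hE
  · refine ⟨0, fun x => ?_⟩
    rw [Subsingleton.elim x 0]
    simp
  obtain ⟨e, he⟩ := exists_ne (0 : E)
  have hq := dualMomentForm_self_pos he
  refine ⟨‖e‖ ^ 2 / dualMomentForm e e, fun x => ?_⟩
  have hx : 0 ≤ dualMomentForm x x / dualMomentForm e e := by
    refine div_nonneg ?_ hq.le
    exact integral_nonneg fun f => mul_self_nonneg (f x)
  -- The factor that gives `s • e` the same moment as `x`.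
  set s := √(dualMomentForm x x / dualMomentForm e e) with hs
  have hss : s * s = dualMomentForm x x / dualMomentForm e e := Real.mul_self_sqrt hx
  have h1 : dualMomentForm x x = dualMomentForm (s • e) (s • e) := by
    rw [dualMomentForm_smul_left, dualMomentForm_smul_right, ← mul_assoc, hss,
      div_mul_cancel₀ _ hq.ne']
  rw [norm_eq_of_dualMomentForm_eq h h1, norm_smul, mul_pow, Real.norm_eq_abs, sq_abs, pow_two s,
    hss]
  ring

theorem isEuclidean_of_reflections
    (h : ∀ x : E, x ≠ 0 → ∃ f : Module.Dual ℝ E, f x = 2 ∧ ∀ y, ‖y - f y • x‖ = ‖y‖) :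
    IsEuclidean E := by
  obtain ⟨c, hc⟩ := exists_norm_sq_eq_mul_dualMomentForm h
  have : InnerProductSpaceable E := ⟨fun x y => by
    simp only [← pow_two, hc, dualMomentForm_add_left, dualMomentForm_add_right,
      dualMomentForm_sub_left, dualMomentForm_sub_right]
    ring⟩
  let : InnerProductSpace ℝ E := InnerProductSpace.ofNorm ℝ this.parallelogram_identity
  exact ⟨(stdOrthonormalBasis ℝ E).repr⟩

end InvariantForm

/-! ### Bisectors in Euclidean space -/

section Euclidean

variable {E : Type*} [NormedAddCommGroup E] [NormedSpace ℝ E] [FiniteDimensional ℝ E]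

/-- A bounded representation lies in the closed subspaces that contain the bisector. -/
theorem boundedRepresentation_subset {x : E} {H : Submodule ℝ E}
    (h : bisector x ⊆ (H : Set E)) : boundedRepresentation x ⊆ (H : Set E) := by
  rintro _ ⟨_, ⟨z, hz, rfl⟩ | ⟨y, ⟨t, v, hmem, ht, hv⟩, rfl⟩, rfl⟩
  · exact H.smul_mem _ (h hz)
  · refine H.closed_of_finiteDimensional.mem_of_tendsto hv ?_
    filter_upwards [ht.eventually_gt_atTop 0] with i hi
    exact (H.smul_mem_iff hi.ne').1 (h (hmem i))

theorem IsEuclidean.exists_boundedRepresentation_subset (hE : IsEuclidean E) {x : E} (hx : x ≠ 0) :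
    ∃ H : Submodule ℝ E, Module.finrank ℝ H + 1 = Module.finrank ℝ E ∧
      boundedRepresentation x ⊆ (H : Set E) := by
  obtain ⟨e⟩ := hE
  let f : Module.Dual ℝ E := (innerₗ _ (e x)).comp e.toLinearEquiv.toLinearMap
  have hf : ∀ z, f z = inner ℝ (e x) (e z) := fun z => rfl
  have hf0 : f ≠ 0 := fun h0 => hx <| by
    have h1 := hf x
    rw [h0, LinearMap.zero_apply, eq_comm, inner_self_eq_zero] at h1
    simpa using h1
  refine ⟨LinearMap.ker f, Module.Dual.finrank_ker_add_one_of_ne_zero hf0,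
    boundedRepresentation_subset fun z hz => ?_⟩
  have hz' : ‖z + x‖ = ‖z - x‖ := hz
  rw [← e.norm_map, ← e.norm_map (z - x), map_add, map_sub] at hz'
  change f z = 0
  rw [hf, real_inner_comm]
  have h1 := norm_add_mul_self_real (e z) (e x)
  have h2 := norm_sub_mul_self_real (e z) (e x)
  rw [hz'] at h1
  linarith

end Euclidean

end Minkowski

theorem corollary1 {E : Type*} [NormedAddCommGroup E] [NormedSpace ℝ E] [FiniteDimensional ℝ E] :
    (∀ x ∈ Metric.sphere (0 : E) 1, ∃ H : Submodule ℝ E,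
        Module.finrank ℝ H + 1 = Module.finrank ℝ E ∧
          Minkowski.boundedRepresentation x ⊆ (H : Set E)) ↔
      Minkowski.IsEuclidean E := by
  refine ⟨fun h => Minkowski.isEuclidean_of_reflections fun x hx => ?_, fun h x hx =>
    h.exists_boundedRepresentation_subset (ne_zero_of_mem_unit_sphere ⟨x, hx⟩)⟩
  have hu : ‖x‖⁻¹ • x ∈ Metric.sphere (0 : E) 1 := by
    simpa using norm_smul_inv_norm (𝕜 := ℝ) hx
  have hx0 : ‖x‖ ≠ 0 := norm_ne_zero_iff.2 hx
  have hu0 : ‖x‖⁻¹ • x ≠ 0 := ne_zero_of_mem_unit_sphere ⟨_, hu⟩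
  obtain ⟨H, hH, hsub⟩ := h _ hu
  have hHtop : H ≠ ⊤ := by
    rintro rfl
    rw [finrank_top] at hH
    omega
  obtain ⟨f, hf, hnorm⟩ := Minkowski.exists_reflection_of_bisector_subset hu0 hHtop
    (Minkowski.bisector_subset_of_boundedRepresentation_subset hu0 hsub)
  -- The reflection depends only on the line of `x`: the factor `‖x‖⁻¹` moves from the vector to the
  -- functional.
  refine ⟨‖x‖⁻¹ • f, by simpa using hf, fun y => ?_⟩
  have h1 := hnorm y
  rwa [smul_smul, mul_comm] at h1
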